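/- Let $\mathrm{Cu}_2$ be the second Cuntz semigroup, that is, the monoid with identity $e$ and zero element $\lozenge$ generated by $s_1,s_2,s_1^*,s_2^*$ subject to the relations $s_1^*s_1=e=s_2^*s_2$ and $s_1^*s_2=\lozenge=s_2^*s_1$. Let $\mathcal A=(\ell^1(\mathrm{Cu}_2\setminus\{\lozenge\}),\#)$ be the complex unital Banach algebra whose product is the bounded bilinear map determined by $\delta_s\#\delta_t=\delta_{st}$ if $st\neq\lozenge$ and $\delta_s\#\delta_t=0$ if $st=\lozenge$. Let $\mathcal J$ be the closed two-sided ideal of $\mathcal A$ generated by $\delta_e-\delta_{s_1s_1^*}-\delta_{s_2s_2^*}$, let $\mathcal A/\mathcal J$ carry the quotient norm, and let $\pi_{\mathcal J}\colon\mathcal A\to\mathcal A/\mathcal J$ be the quotient map. Fix $p\in[1,\infty)$, let $\ell^p=\ell^p(\mathbb N)$ be the space of complex $p$-summable sequences indexed by $\mathbb N=\{1,2,\dots\}$, and define bounded operators $A_1,A_2\in\mathcal B(\ell^p)$ by $(A_1x)(n)=x_{2n}$ and $(A_2x)(n)=x_{2n-1}$. Let $\Theta\colon\mathcal A/\mathcal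 J\to\mathcal B(\ell^p)$ be a continuous (complex-linear, multiplicative, not assumed unital) algebra homomorphism such that $\Theta(\pi_{\mathcal J}(\delta_{s_i^*}))=A_i$ for $i\in\{1,2\}$. Then: 1. $\Theta$ is injective; 2. $\Theta$ is not bounded below, i.e. there is no constant $c>0$ with $\|\Theta(a)\|\geq c\|a\|$ for all $a\in\mathcal A/\mathcal J$; 3. with $h=(\delta_{s_1^*}+\delta_{s_2^*})/2\in\mathcal A$, for every integer $N\geq 0$ one has $$\|\pi_{\mathcal J}(h^N)\|=1\qquad\text{and}\qquad\|\Theta(\pi_{\mathcal J}(h^N))\|=2^{-N/p}.$$ -/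

import Mathlib

open scoped ENNReal

noncomputable section

namespace CuntzAlg

/-! ## The semigroup algebra of a monoid with zero

For a monoid with zero `S` we build the unital Banach algebra `(ℓ¹(S \ {0}), #)`, in which the zero
of `S` is identified with the zero of the algebra. -/

/-- The Banach space `ℓ¹(S \ {0})` of absolutely summable complex functions on `S \ {0}`. -/
abbrev L1 (S : Type) [MonoidWithZero S] : Type := lp (fun _ : {s : S // s ≠ 0} => ℂ) 1

section L1

variable {S : Type} [MonoidWithZero S]

open Classical in
/-- The point mass `δ_s` for `s ≠ 0`; the point mass at the zero of `S` is set to be `0`. -/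
def delta (s : S) : L1 S :=
  if h : s = 0 then 0 else lp.single 1 (⟨s, h⟩ : {s : S // s ≠ 0}) (1 : ℂ)

theorem hasSum_norm (f : L1 S) : HasSum (fun s => ‖f s‖) ‖f‖ := by
  simpa using lp.hasSum_norm (p := 1) (by simp) f

open Classical in
theorem delta_eq_single (s : {s : S // s ≠ 0}) : delta (s : S) = lp.single 1 s (1 : ℂ) := by
  unfold delta
  rw [dif_neg s.2]

theorem norm_delta_le (s : S) : ‖delta s‖ ≤ 1 := by
  classical
  by_cases h : s = 0
  · simp [delta, h]
  · rw [delta, dif_neg h, lp.norm_single one_pos, norm_one]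

theorem hasSum_delta (f : L1 S) : HasSum (fun s => f s • delta (s : S)) f := by
  classical
  have := lp.hasSum_single (p := 1) ENNReal.one_ne_top f
  convert this using 2 with s
  rw [delta_eq_single, ← lp.single_smul, smul_eq_mul, mul_one]

variable {E : Type} [NormedAddCommGroup E] [NormedSpace ℂ E] [CompleteSpace E]

theorem summable_extend {φ : S → E} (hφ : ∀ s, ‖φ s‖ ≤ 1) (f : L1 S) :
    Summable (fun s : {s : S // s ≠ 0} => f s • φ s) := by
  refine Summable.of_norm_bounded (hasSum_norm f).summable (fun s => ?_)
  rw [norm_smul]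
  exact mul_le_of_le_one_right (norm_nonneg _) (hφ s)

/-- The contractive linear extension `f ↦ ∑ f(s) φ(s)` to `ℓ¹(S \ {0})` of a map `φ` from `S` to
the unit ball of a Banach space. -/
def extend (φ : S → E) (hφ : ∀ s, ‖φ s‖ ≤ 1) : L1 S →L[ℂ] E :=
  LinearMap.mkContinuous
    { toFun := fun f => ∑' s : {s : S // s ≠ 0}, f s • φ s
      map_add' := fun f g => by
        rw [← (summable_extend hφ f).tsum_add (summable_extend hφ g)]
        refine tsum_congr fun s => ?_
        rw [← add_smul]
        rfl
      map_smul' := fun c f => by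
        rw [RingHom.id_apply, ← (summable_extend hφ f).tsum_const_smul c]
        refine tsum_congr fun s => ?_
        rw [smul_smul]
        rfl } 1 (fun f => by
      rw [one_mul]
      refine tsum_of_norm_bounded (hasSum_norm f) (fun s => ?_)
      rw [norm_smul]
      exact mul_le_of_le_one_right (norm_nonneg _) (hφ s))

theorem norm_extend_le (φ : S → E) (hφ : ∀ s, ‖φ s‖ ≤ 1) : ‖extend φ hφ‖ ≤ 1 :=
  LinearMap.mkContinuous_norm_le _ zero_le_one _

theorem extend_delta (φ : S → E) (hφ : ∀ s, ‖φ s‖ ≤ 1) (h0 : φ 0 = 0) (s : S) :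
    extend φ hφ (delta s) = φ s := by
  classical
  by_cases h : s = 0
  · simp [h, h0, delta]
  · change ∑' t : {s : S // s ≠ 0}, delta s t • φ t = φ s
    rw [delta, dif_neg h, tsum_eq_single ⟨s, h⟩]
    · simp
    · intro t ht
      simp [ht]

theorem ext_delta {F : Type} [NormedAddCommGroup F] [NormedSpace ℂ F] {T U : L1 S →L[ℂ] F}
    (h : ∀ s, T (delta s) = U (delta s)) : T = U := by
  ext f
  refine ((hasSum_delta f).mapL T).unique ?_
  convert (hasSum_delta f).mapL U using 2 with s
  simp [h]

/-- The product `#` as a bounded bilinear map: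
`f # g = ∑_s ∑_t f(s) g(t) δ_{st}`, where `δ_{st} = 0` if `st = 0`. -/
def mulL : L1 S →L[ℂ] L1 S →L[ℂ] L1 S :=
  extend (fun s => extend (fun t => delta (s * t)) (fun _ => norm_delta_le _))
    (fun _ => norm_extend_le _ _)

instance : Mul (L1 S) := ⟨fun f g => mulL f g⟩

instance : One (L1 S) := ⟨delta 1⟩

theorem mul_def (f g : L1 S) : f * g = mulL f g := rfl

theorem one_def : (1 : L1 S) = delta 1 := rfl

theorem delta_zero : delta (0 : S) = 0 := by simp [delta]

theorem delta_mul_delta (s t : S) : delta s * delta t = delta (s * t) := by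
  rw [mul_def, mulL, extend_delta, extend_delta]
  · simp [delta_zero]
  · refine ext_delta fun t => ?_
    rw [extend_delta] <;> simp [delta_zero]

theorem l1_one_mul (f : L1 S) : 1 * f = f := by
  have : mulL (delta (1 : S)) = ContinuousLinearMap.id ℂ (L1 S) := by
    refine ext_delta fun s => ?_
    rw [← mul_def, delta_mul_delta, one_mul]
    rfl
  exact congrArg (fun T : L1 S →L[ℂ] L1 S => T f) this

theorem l1_mul_one (f : L1 S) : f * 1 = f := by
  have : mulL.flip (delta (1 : S)) = ContinuousLinearMap.id ℂ (L1 S) := by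
    refine ext_delta fun s => ?_
    rw [ContinuousLinearMap.flip_apply, ← mul_def, delta_mul_delta, mul_one]
    rfl
  exact congrArg (fun T : L1 S →L[ℂ] L1 S => T f) this

theorem l1_mul_assoc (f g h : L1 S) : f * g * h = f * (g * h) := by
  have h1 : ∀ s t : S, ∀ h : L1 S, delta s * delta t * h = delta s * (delta t * h) := by
    intro s t h
    have : mulL (delta s * delta t) = (mulL (delta s)).comp (mulL (delta t)) := by
      refine ext_delta fun u => ?_
      rw [ContinuousLinearMap.comp_apply, ← mul_def, ← mul_def, ← mul_def,
        delta_mul_delta, delta_mul_delta, delta_mul_delta, delta_mul_delta, mul_assoc]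
    exact congrArg (fun T : L1 S →L[ℂ] L1 S => T h) this
  have h2 : ∀ s : S, ∀ g h : L1 S, delta s * g * h = delta s * (g * h) := by
    intro s g h
    have : (mulL.flip h).comp (mulL (delta s)) = (mulL (delta s)).comp (mulL.flip h) :=
      ext_delta fun t => h1 s t h
    exact congrArg (fun T : L1 S →L[ℂ] L1 S => T g) this
  have : (mulL.flip h).comp (mulL.flip g) = mulL.flip (g * h) :=
    ext_delta fun s => h2 s g h
  exact congrArg (fun T : L1 S →L[ℂ] L1 S => T f) this

instance : NormedRing (L1 S) where
  __ := (inferInstance : NormedAddCommGroup (L1 S))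
  mul := (· * ·)
  one := 1
  left_distrib f g h := map_add (mulL f) g h
  right_distrib f g h := by
    change mulL (f + g) h = mulL f h + mulL g h
    rw [map_add, _root_.add_apply]
  zero_mul f := by
    change mulL 0 f = 0
    rw [map_zero, _root_.zero_apply]
  mul_zero f := map_zero (mulL f)
  mul_assoc := l1_mul_assoc
  one_mul := l1_one_mul
  mul_one := l1_mul_one
  dist_eq := NormedAddGroup.dist_eq
  norm_mul_le f g := by
    refine (mulL f).le_of_opNorm_le ?_ g
    simpa using mulL.le_of_opNorm_le (norm_extend_le _ _) f

instance : NormedAlgebra ℂ (L1 S) where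
  __ := Algebra.ofModule (R := ℂ) (A := L1 S)
    (fun c f g => by
      change mulL (c • f) g = c • mulL f g
      rw [map_smul, _root_.smul_apply])
    (fun c f g => map_smul (mulL f) c g)
  norm_smul_le := norm_smul_le

end L1

/-! ## Quotients of Banach algebras by closed two-sided ideals -/

section Quotient

variable {R : Type} [NormedRing R]

/-- The closed two-sided ideal generated by `a`, i.e. the smallest one containing `a`. -/
def closedIdeal (a : R) : Ideal R :=
  sInf {I : Ideal R | I.IsTwoSided ∧ IsClosed (I : Set R) ∧ a ∈ I}

instance (a : R) : (closedIdeal a).IsTwoSided where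
  mul_mem_of_left {x} y hx := by
    rw [closedIdeal, Submodule.mem_sInf] at hx ⊢
    intro I hI
    have := hI.1
    exact Ideal.mul_mem_right y I (hx I hI)

instance (a : R) : IsClosed (closedIdeal a : Set R) := by
  rw [closedIdeal, Submodule.coe_sInf]
  exact isClosed_biInter fun I hI => hI.2.1

/-- The quotient of a normed ring by a closed two-sided ideal, with the quotient norm. -/
instance (I : Ideal R) [I.IsTwoSided] [IsClosed (I : Set R)] : NormedRing (R ⧸ I) where
  __ := Submodule.Quotient.normedAddCommGroup I
  __ := Ideal.Quotient.ring I
  norm_mul_le x y := by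
    refine le_of_forall_pos_le_add fun ε hε => ?_
    have := ((Metric.nhds_basis_ball.prod_nhds Metric.nhds_basis_ball).tendsto_iff
      Metric.nhds_basis_ball).mp (continuous_mul.tendsto (‖x‖, ‖y‖)) ε hε
    simp only [Set.mem_prod, Metric.mem_ball, and_imp, Prod.forall, Prod.exists] at this
    rcases this with ⟨ε₁, ε₂, ⟨h₁, h₂⟩, h⟩
    obtain ⟨a, rfl, ha⟩ := Submodule.Quotient.norm_mk_lt x h₁
    obtain ⟨b, rfl, hb⟩ := Submodule.Quotient.norm_mk_lt y h₂
    simp only [dist, abs_sub_lt_iff] at h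
    specialize h ‖a‖ ‖b‖ ⟨by linarith, by linarith [Submodule.Quotient.norm_mk_le I a]⟩
      ⟨by linarith, by linarith [Submodule.Quotient.norm_mk_le I b]⟩
    calc
      _ ≤ ‖a‖ * ‖b‖ := (Submodule.Quotient.norm_mk_le I (a * b)).trans (norm_mul_le a b)
      _ ≤ _ := (sub_lt_iff_lt_add'.mp h.1).le

instance [NormedAlgebra ℂ R] (I : Ideal R) [I.IsTwoSided] [IsClosed (I : Set R)] :
    NormedAlgebra ℂ (R ⧸ I) where
  __ := Ideal.Quotient.algebra ℂ (A := R) (I := I)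
  norm_smul_le := (Submodule.Quotient.normedSpace I ℂ).norm_smul_le

end Quotient

/-! ## The Cuntz semigroup -/

/-- The four generators `s₁, s₂, s₁*, s₂*`. -/
inductive Gen : Type
  | s₁ | s₂ | s₁star | s₂star

/-- The word of length one in the free monoid with zero on the four generators. -/
def letter (g : Gen) : WithZero (FreeMonoid Gen) := ((FreeMonoid.of g : FreeMonoid Gen) : WithZero _)

/-- The relations `s₁* s₁ = e = s₂* s₂` and `s₁* s₂ = 0 = s₂* s₁`. -/
inductive Rel : WithZero (FreeMonoid Gen) → WithZero (FreeMonoid Gen) → Prop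
  | one_one : Rel (letter .s₁star * letter .s₁) 1
  | two_two : Rel (letter .s₂star * letter .s₂) 1
  | one_two : Rel (letter .s₁star * letter .s₂) 0
  | two_one : Rel (letter .s₂star * letter .s₁) 0

/-- The second Cuntz semigroup `Cu₂`: the monoid with zero presented by the generators
`s₁, s₂, s₁*, s₂*` and the relations `s₁* s₁ = e = s₂* s₂`, `s₁* s₂ = 0 = s₂* s₁`. -/
def Cu₂ : Type := (conGen Rel).Quotient

instance : Monoid Cu₂ := inferInstanceAs (Monoid (conGen Rel).Quotient)

/-- The class in `Cu₂` of an element of the free monoid with zero. -/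
def Cu₂.mk : WithZero (FreeMonoid Gen) →* Cu₂ := (conGen Rel).mk'

theorem Cu₂.mk_surjective : Function.Surjective Cu₂.mk := Con.mk'_surjective

instance : MonoidWithZero Cu₂ where
  __ := (inferInstance : Monoid Cu₂)
  zero := Cu₂.mk 0
  zero_mul x := by
    obtain ⟨w, rfl⟩ := Cu₂.mk_surjective x
    change Cu₂.mk 0 * Cu₂.mk w = Cu₂.mk 0
    rw [← map_mul, zero_mul]
  mul_zero x := by
    obtain ⟨w, rfl⟩ := Cu₂.mk_surjective x
    change Cu₂.mk w * Cu₂.mk 0 = Cu₂.mk 0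
    rw [← map_mul, mul_zero]

/-- The generators as elements of `Cu₂`. -/
def gen (g : Gen) : Cu₂ := Cu₂.mk (letter g)

/-! ## The algebra `𝒜`, the ideal `𝒥` and the quotient `𝒜/𝒥` -/

/-- The unital Banach algebra `𝒜 = (ℓ¹(Cu₂ \ {0}), #)`. -/
abbrev 𝒜 : Type := L1 Cu₂

/-- The element `f₀ = δ_e - δ_{s₁ s₁*} - δ_{s₂ s₂*}`. -/
def f₀ : 𝒜 := delta 1 - delta (gen .s₁ * gen .s₁star) - delta (gen .s₂ * gen .s₂star)

/-- The closed two-sided ideal of `𝒜` generated by `f₀`. -/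
abbrev 𝒥 : Ideal 𝒜 := closedIdeal f₀

/-- The quotient map `𝒜 → 𝒜/𝒥`. -/
abbrev π𝒥 : 𝒜 →+* 𝒜 ⧸ 𝒥 := Ideal.Quotient.mk 𝒥

/-- The element `h = (δ_{s₁*} + δ_{s₂*}) / 2` of `𝒜`. -/
def hElt : 𝒜 := (1 / 2 : ℂ) • (delta (gen .s₁star) + delta (gen .s₂star))

/-! ## The operators `A₁` and `A₂` on `ℓᵖ` -/

/-- The Banach space `ℓᵖ(ℕ)` of complex sequences, indexed by `1, 2, 3, …`. -/
abbrev ellp (p : ℝ≥0∞) : Type := lp (fun _ : ℕ+ => ℂ) p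

section Operators

variable (p : ℝ≥0∞) [Fact (1 ≤ p)]

theorem memℓp_comp (hp : p ≠ ∞) {σ : ℕ+ → ℕ+} (hσ : Function.Injective σ) (x : ellp p) :
    Memℓp (fun n => x (σ n)) p := by
  have hp0 : 0 < p.toReal := ENNReal.toReal_pos (zero_lt_one.trans_le Fact.out).ne' hp
  exact memℓp_gen ((lp.memℓp x).summable hp0 |>.comp_injective hσ)

/-- The contraction `(x_n) ↦ (x_{σ(n)})` on `ℓᵖ`, for an injection `σ`. -/
def compOp (hp : p ≠ ∞) (σ : ℕ+ → ℕ+) (hσ : Function.Injective σ) : ellp p →L[ℂ] ellp p :=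
  LinearMap.mkContinuous
    { toFun := fun x => ⟨fun n => x (σ n), memℓp_comp p hp hσ x⟩
      map_add' := fun _ _ => rfl
      map_smul' := fun _ _ => rfl } 1 (fun x => by
      have hp0 : 0 < p.toReal := ENNReal.toReal_pos (zero_lt_one.trans_le Fact.out).ne' hp
      rw [one_mul]
      refine lp.norm_le_of_tsum_le hp0 (norm_nonneg _) ?_
      rw [lp.norm_rpow_eq_tsum hp0 x]
      have hs := (lp.memℓp x).summable hp0
      exact (hs.comp_injective hσ).tsum_le_tsum_of_inj σ hσ (fun _ _ => by positivity)
        (fun _ => le_rfl) hs)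

theorem two_mul_injective : Function.Injective (fun n : ℕ+ => 2 * n) :=
  mul_right_injective 2

theorem two_mul_sub_one_injective : Function.Injective (fun n : ℕ+ => 2 * n - 1) := by
  intro m n h
  have h' := congrArg PNat.val h
  have hm : (1 : ℕ+) < 2 * m := by
    rw [← PNat.coe_lt_coe, PNat.mul_coe]
    have := m.pos
    simp
    lia
  have hn : (1 : ℕ+) < 2 * n := by
    rw [← PNat.coe_lt_coe, PNat.mul_coe]
    have := n.pos
    simp
    lia
  simp only [PNat.sub_coe, hm, hn, if_true, PNat.mul_coe, PNat.val_ofNat] at h'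
  apply PNat.eq
  have := m.pos
  have := n.pos
  lia

/-- `(A₁ x)(n) = x_{2n}`. -/
def A₁ (hp : p ≠ ∞) : ellp p →L[ℂ] ellp p := compOp p hp (fun n => 2 * n) two_mul_injective

/-- `(A₂ x)(n) = x_{2n-1}`. -/
def A₂ (hp : p ≠ ∞) : ellp p →L[ℂ] ellp p :=
  compOp p hp (fun n => 2 * n - 1) two_mul_sub_one_injective

end Operators

/-- A map between normed spaces is bounded below if `‖T a‖ ≥ c ‖a‖` for some constant `c > 0`. -/
def BoundedBelow {E F : Type} [Norm E] [Norm F] (T : E → F) : Prop :=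
  ∃ c : ℝ, 0 < c ∧ ∀ a, c * ‖a‖ ≤ ‖T a‖

end CuntzAlg

end

/-! The norm claims compare two representations. On `ℓᵖ`, `h` acts by averaging the even and odd
subsequences; convexity of `t ↦ t ^ p` bounds this average by `2 ^ (-1/p)`, and the indicator of
`{1, …, 2 ^ N}` shows that the `N`-th power of the bound is sharp (`norm_avg_pow`). On bounded
functions of binary sequences there is a contractive representation killing `f₀` in which `h` fixes
the constant `1`, so the quotient norm of `h ^ N` cannot drop below `1` (`norm_π𝒥_hElt_pow`). Since
`2 ^ (-N/p) → 0`, `Θ` is not bounded below.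

Injectivity needs only continuity and `Θ 1 ≠ 0`. Write `w_k = 1⋯12` with `k` letters `1`. Each `t`
in `Cu₂` satisfies `s_{w_k}* t s_{w_k} = e` for all large `k`, or `= 0` for all large `k`. By
dominated convergence the compressions of any `f` converge in norm to `χ(f) 1` for a functional `χ`
(`tendsto_compress`). Hence `Θ(π f) = 0` forces `χ(f) = 0`, and, the kernel being an ideal, `χ(s_α*
f s_β) = 0` for all `α`, `β`.

These coefficients determine `f` modulo `𝒥`. The map `C(f) = ∑_α χ(s_α* f) s_α` is contractive and
fixes every `s_α`; as `∑ s_i s_i* = 1` in the quotient, the sums `∑_{|β| = n} C(f s_β) s_β*`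
converge to `π(f)` there (`tendsto_recon`). -/

noncomputable section

open Filter Topology

namespace CuntzAlg

/-! ### Strong convergence and homomorphisms on `ℓ¹` of a monoid with zero -/

section L1

variable {S : Type} [MonoidWithZero S]
variable {E : Type} [NormedAddCommGroup E] [NormedSpace ℂ E] [CompleteSpace E]

/-- Convergence on point masses implies strong convergence, for operators on `ℓ¹` that are
contractive on point masses. -/
theorem tendsto_apply_of_delta (T : ℕ → L1 S →L[ℂ] E) (U : L1 S →L[ℂ] E)
    (hT : ∀ n s, ‖T n (delta s)‖ ≤ 1)
    (h : ∀ s, Tendsto (fun n => T n (delta s)) atTop (𝓝 (U (delta s))))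
    (f : L1 S) : Tendsto (fun n => T n f) atTop (𝓝 (U f)) := by
  have e : ∀ V : L1 S →L[ℂ] E, V f = ∑' s : {s : S // s ≠ 0}, f s • V (delta (s : S)) := by
    intro V
    rw [← ((hasSum_delta f).mapL V).tsum_eq]
    exact tsum_congr fun s => map_smul V _ _
  rw [e U]
  simp_rw [e (T _)]
  refine tendsto_tsum_of_dominated_convergence (bound := fun s => ‖f s‖) (hasSum_norm f).summable
    (fun s => (h s).const_smul _) (Eventually.of_forall fun n s => ?_)
  rw [norm_smul]
  exact mul_le_of_le_one_right (norm_nonneg _) (hT n s)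

section Hom

variable {B : Type} [NormedRing B] [NormedAlgebra ℂ B] [CompleteSpace B]

/-- The extension to `ℓ¹(S \ {0})` of a homomorphism to the unit ball of a Banach algebra. -/
def extendHom (φ : S →*₀ B) (hφ : ∀ s, ‖φ s‖ ≤ 1) : L1 S →+* B where
  toFun := extend φ hφ
  map_one' := by rw [one_def, extend_delta _ _ (map_zero φ), map_one]
  map_mul' f g := by
    -- Multiplicativity is known on pairs of point masses and is extended one variable at a time.
    have h1 : ∀ s : S, (extend φ hφ).comp (mulL (delta s)) =
        (ContinuousLinearMap.mul ℂ B (φ s)).comp (extend φ hφ) := fun s => ext_delta fun t => by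
      change extend φ hφ (delta s * delta t) = φ s * extend φ hφ (delta t)
      rw [delta_mul_delta, extend_delta _ _ (map_zero φ), extend_delta _ _ (map_zero φ), map_mul]
    have h2 : (extend φ hφ).comp (mulL.flip g) =
        ((ContinuousLinearMap.mul ℂ B).flip (extend φ hφ g)).comp (extend φ hφ) :=
      ext_delta fun s => by
        change extend φ hφ (mulL (delta s) g) = extend φ hφ (delta s) * extend φ hφ g
        rw [extend_delta _ _ (map_zero φ)]
        exact congrArg (fun T : L1 S →L[ℂ] B => T g) (h1 s)
    exact congrArg (fun T : L1 S →L[ℂ] B => T f) h2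
  map_zero' := map_zero _
  map_add' := map_add _

theorem extendHom_delta (φ : S →*₀ B) (hφ : ∀ s, ‖φ s‖ ≤ 1) (s : S) :
    extendHom φ hφ (delta s) = φ s := extend_delta _ _ (map_zero φ) s

theorem extendHom_smul (φ : S →*₀ B) (hφ : ∀ s, ‖φ s‖ ≤ 1) (c : ℂ) (f : L1 S) :
    extendHom φ hφ (c • f) = c • extendHom φ hφ f := map_smul (extend φ hφ) c f

theorem norm_extendHom_le (φ : S →*₀ B) (hφ : ∀ s, ‖φ s‖ ≤ 1) (f : L1 S) :
    ‖extendHom φ hφ f‖ ≤ ‖f‖ :=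
  ((extend φ hφ).le_of_opNorm_le (norm_extend_le _ _) f).trans (one_mul _).le

end Hom

end L1

/-! ### Words in the Cuntz semigroup -/

/-- The isometries `s₁` (for `true`) and `s₂` (for `false`). -/
def isom (i : Bool) : Cu₂ := bif i then gen .s₁ else gen .s₂

/-- The adjoints `s₁*` (for `true`) and `s₂*` (for `false`). -/
def coisom (i : Bool) : Cu₂ := bif i then gen .s₁star else gen .s₂star

theorem mk_eq_of_rel {x y : WithZero (FreeMonoid Gen)} (h : Rel x y) : Cu₂.mk x = Cu₂.mk y :=
  (Con.eq _).2 (ConGen.Rel.of _ _ h)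

theorem coisom_mul_isom (i j : Bool) : coisom i * isom j = if i = j then 1 else 0 := by
  cases i <;> cases j
  · exact mk_eq_of_rel .two_two
  · exact mk_eq_of_rel .two_one
  · exact mk_eq_of_rel .one_two
  · exact mk_eq_of_rel .one_one

/-- The product `s_α` of the isometries along a word. -/
def word : List Bool → Cu₂
  | [] => 1
  | i :: α => isom i * word α

/-- The adjoint `s_α*` of `s_α`. -/
def coword : List Bool → Cu₂
  | [] => 1
  | i :: α => coword α * coisom i

theorem coword_concat (β : List Bool) (i : Bool) : coword (β ++ [i]) = coisom i * coword β := by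
  induction β with
  | nil => simp [coword]
  | cons j β ih => simp [coword, ih, mul_assoc]

theorem word_append (α β : List Bool) : word (α ++ β) = word α * word β := by
  induction α with
  | nil => simp [word]
  | cons j α ih => simp [word, ih, mul_assoc]

theorem coword_append (α β : List Bool) : coword (α ++ β) = coword β * coword α := by
  induction α with
  | nil => simp [coword]
  | cons j α ih => simp [coword, ih, mul_assoc]

theorem coword_mul_word (α : List Bool) : coword α * word α = 1 := by
  induction α with
  | nil => simp [coword, word]
  | cons j α ih =>
    rw [coword, word, mul_assoc, ← mul_assoc (coisom j), coisom_mul_isom, if_pos rfl, one_mul, ih]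

/-- Every nonzero element of `Cu₂` is of the form `s_α s_β*`. -/
theorem eq_zero_or_eq_word_mul_coword (x : Cu₂) : x = 0 ∨ ∃ α β, x = word α * coword β := by
  obtain ⟨w, rfl⟩ := Cu₂.mk_surjective x
  induction w with
  | zero => exact Or.inl rfl
  | coe w =>
    induction w using FreeMonoid.recOn with
    | one => exact Or.inr ⟨[], [], by simp only [word, coword, mul_one]; exact map_one Cu₂.mk⟩
    | of_mul g w ih =>
      have e : Cu₂.mk ((FreeMonoid.of g * w : FreeMonoid Gen) : WithZero _) = gen g * Cu₂.mk w := by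
        rw [WithZero.coe_mul, map_mul]; rfl
      have hi : ∀ i : Bool, isom i * Cu₂.mk w = 0 ∨
          ∃ α β, isom i * Cu₂.mk w = word α * coword β := by
        intro i
        rcases ih with h | ⟨α, β, h⟩
        · exact Or.inl (by rw [h, mul_zero])
        · exact Or.inr ⟨i :: α, β, by rw [h, word, mul_assoc]⟩
      have hc : ∀ i : Bool, coisom i * Cu₂.mk w = 0 ∨
          ∃ α β, coisom i * Cu₂.mk w = word α * coword β := by
        intro i
        rcases ih with h | ⟨α, β, h⟩
        · exact Or.inl (by rw [h, mul_zero])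
        · rw [h]
          cases α with
          | nil => exact Or.inr ⟨[], β ++ [i], by simp [word, coword_concat]⟩
          | cons j α =>
            rw [word, mul_assoc, ← mul_assoc (coisom i), coisom_mul_isom]
            split_ifs
            · exact Or.inr ⟨α, β, by rw [one_mul]⟩
            · exact Or.inl (zero_mul _)
      rw [e]
      cases g
      · exact hi true
      · exact hi false
      · exact hc true
      · exact hc false

/-! ### The universal property of the Cuntz semigroup -/

section Lift

variable {M : Type*} [MonoidWithZero M] (a b : Bool → M)

/-- The values on the generators of the homomorphism with `s_i ↦ a i` and `s_i* ↦ b i`. -/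
def genMap : Gen → M
  | .s₁ => a true
  | .s₂ => a false
  | .s₁star => b true
  | .s₂star => b false

/-- The homomorphism from the free monoid with zero. -/
def freeLift : WithZero (FreeMonoid Gen) →*₀ M := WithZero.lift' (FreeMonoid.lift (genMap a b))

theorem freeLift_letter (g : Gen) : freeLift a b (letter g) = genMap a b g := by
  simp [freeLift, letter]

variable (h : ∀ i j, b i * a j = if i = j then 1 else 0)

/-- The homomorphism from `Cu₂` given by elements satisfying the defining relations. -/
def cuLift : Cu₂ →*₀ M where
  __ := Con.lift (conGen Rel) (freeLift a b : WithZero (FreeMonoid Gen) →* M) (by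
    refine Con.conGen_le.2 fun x y hxy => ?_
    change freeLift a b x = freeLift a b y
    cases hxy <;> simp [freeLift_letter, genMap, h])
  map_zero' := (freeLift a b).map_zero

theorem cuLift_gen (g : Gen) : cuLift a b h (gen g) = genMap a b g := freeLift_letter a b g

theorem cuLift_isom (i : Bool) : cuLift a b h (isom i) = a i := by
  cases i
  · exact cuLift_gen a b h .s₂
  · exact cuLift_gen a b h .s₁

theorem cuLift_coisom (i : Bool) : cuLift a b h (coisom i) = b i := by
  cases i
  · exact cuLift_gen a b h .s₂star
  · exact cuLift_gen a b h .s₁star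

end Lift

/-! ### Contractive representations on Banach spaces -/

theorem f₀_eq : f₀ = delta 1 - delta (isom true * coisom true) - delta (isom false * coisom false) :=
  rfl

theorem hElt_eq : hElt = (1 / 2 : ℂ) • (delta (coisom true) + delta (coisom false)) := rfl

theorem norm_π𝒥_le (f : 𝒜) : ‖π𝒥 f‖ ≤ ‖f‖ := Submodule.Quotient.norm_mk_le 𝒥 f

theorem norm_π𝒥_hElt_pow_le (N : ℕ) : ‖π𝒥 (hElt ^ N)‖ ≤ 1 := by
  refine (norm_π𝒥_le _).trans ?_
  have h1 : ‖hElt‖ ≤ 1 := by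
    rw [hElt_eq, norm_smul]
    have := norm_add_le (delta (coisom true)) (delta (coisom false))
    have h1 := norm_delta_le (coisom true)
    have h2 := norm_delta_le (coisom false)
    norm_num
    linarith
  induction N with
  | zero => rw [pow_zero]; exact norm_delta_le 1
  | succ N ih =>
    rw [pow_succ]
    exact (norm_mul_le _ _).trans (mul_le_one₀ ih (norm_nonneg _) h1)

/-- A contractive homomorphism that annihilates `f₀` factors contractively through `𝒜/𝒥`. -/
theorem norm_map_le_norm_π𝒥 {B : Type} [NormedRing B] (ρ : 𝒜 →+* B)
    (hρ : ∀ f, ‖ρ f‖ ≤ ‖f‖) (ha : ρ f₀ = 0) (f : 𝒜) :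
    ‖ρ f‖ ≤ ‖π𝒥 f‖ := by
  have hc : Continuous ρ := AddMonoidHomClass.continuous_of_bound ρ 1 (by simpa using hρ)
  have hker : 𝒥 ≤ RingHom.ker ρ :=
    sInf_le ⟨inferInstance, isClosed_singleton.preimage hc, ha⟩
  refine le_of_forall_pos_le_add fun ε hε => ?_
  obtain ⟨g, hg, hlt⟩ :=
    Submodule.Quotient.norm_mk_lt (S := 𝒥) (π𝒥 f) hε
  have hfg : ρ (g - f) = 0 := hker (Ideal.Quotient.eq.1 hg)
  rw [map_sub, sub_eq_zero] at hfg
  rw [← hfg]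
  exact (hρ g).trans hlt.le

section Rep

variable {E : Type} [NormedAddCommGroup E] [NormedSpace ℂ E] {a b : Bool → E →L[ℂ] E}
  (h : ∀ i j, b i * a j = if i = j then 1 else 0)

/-- By the normal form `s_α s_β*`, it is enough that the generators act contractively. -/
theorem norm_cuLift_le (ha : ∀ i v, ‖a i v‖ ≤ ‖v‖) (hb : ∀ i v, ‖b i v‖ ≤ ‖v‖) (s : Cu₂) :
    ‖cuLift a b h s‖ ≤ 1 := by
  have ha' : ∀ i, ‖a i‖ ≤ 1 := fun i =>
    (a i).opNorm_le_bound zero_le_one (by simpa using ha i)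
  have hb' : ∀ i, ‖b i‖ ≤ 1 := fun i =>
    (b i).opNorm_le_bound zero_le_one (by simpa using hb i)
  have hw : ∀ α, ‖cuLift a b h (word α)‖ ≤ 1 := by
    intro α
    induction α with
    | nil => rw [word, map_one]; exact ContinuousLinearMap.norm_id_le
    | cons i α ih =>
      rw [word, map_mul, cuLift_isom]
      exact (norm_mul_le _ _).trans (mul_le_one₀ (ha' i) (norm_nonneg _) ih)
  have hc : ∀ α, ‖cuLift a b h (coword α)‖ ≤ 1 := by
    intro α
    induction α with
    | nil => rw [coword, map_one]; exact ContinuousLinearMap.norm_id_le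
    | cons i α ih =>
      rw [coword, map_mul, cuLift_coisom]
      exact (norm_mul_le _ _).trans (mul_le_one₀ ih (norm_nonneg _) (hb' i))
  rcases eq_zero_or_eq_word_mul_coword s with rfl | ⟨α, β, rfl⟩
  · simp
  · rw [map_mul]
    exact (norm_mul_le _ _).trans (mul_le_one₀ (hw α) (norm_nonneg _) (hc β))

/-- A contractive representation of `𝒜/𝒥` in which both `s_i*` fix a nonzero vector witnesses that
the powers of `h` have quotient norm at least `1`. -/
theorem one_le_norm_π𝒥_hElt_pow [CompleteSpace E]
    (h : ∀ i j, b i * a j = if i = j then 1 else 0) (ha : ∀ i v, ‖a i v‖ ≤ ‖v‖)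
    (hb : ∀ i v, ‖b i v‖ ≤ ‖v‖) (hab : a true * b true + a false * b false = 1)
    {v : E} (hv : v ≠ 0) (hbv : ∀ i, b i v = v) (N : ℕ) : 1 ≤ ‖π𝒥 (hElt ^ N)‖ := by
  set ρ : 𝒜 →+* (E →L[ℂ] E) := extendHom (cuLift a b h) (norm_cuLift_le h ha hb) with hρ
  have hδ : ∀ s, ρ (delta s) = cuLift a b h s := extendHom_delta _ _
  have h0 : ρ f₀ = 0 := by
    rw [f₀_eq, map_sub, map_sub, hδ, hδ, hδ, map_mul, map_mul, map_one, cuLift_isom, cuLift_isom,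
      cuLift_coisom, cuLift_coisom, sub_sub, hab, sub_self]
  refine le_trans ?_ (norm_map_le_norm_π𝒥 ρ (norm_extendHom_le _ _) h0 _)
  have h1 : ρ hElt v = v := by
    rw [hElt_eq, hρ, extendHom_smul, map_add, extendHom_delta, extendHom_delta,
      cuLift_coisom, cuLift_coisom]
    change (1 / 2 : ℂ) • (b true v + b false v) = v
    rw [hbv, hbv, ← two_smul ℂ, smul_smul]
    norm_num
  have h2 : ρ (hElt ^ N) v = v := by
    rw [map_pow]
    induction N with
    | zero => rfl
    | succ N ih =>
      rw [pow_succ]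
      change (ρ hElt ^ N) (ρ hElt v) = v
      rw [h1, ih]
  have h3 := (ρ (hElt ^ N)).le_opNorm v
  rw [h2] at h3
  exact (le_mul_iff_one_le_left (norm_pos_iff.2 hv)).1 h3

end Rep

/-! ### A contractive representation on bounded functions on the Cantor set -/

-- With the discrete topology every bounded function is continuous, so `BddFun` is the full sup-norm
-- space.
local instance : TopologicalSpace (Stream' Bool) := ⊥
local instance : DiscreteTopology (Stream' Bool) := ⟨rfl⟩

/-- The bounded functions on the set of binary sequences. -/
abbrev BddFun : Type := BoundedContinuousFunction (Stream' Bool) ℂ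

/-- The contraction `(b_i f)(x) = f(i x)`. -/
def pull (i : Bool) : BddFun →L[ℂ] BddFun :=
  LinearMap.mkContinuous
    { toFun := fun f => f.compContinuous ⟨fun x => Stream'.cons i x, continuous_of_discreteTopology⟩
      map_add' := fun _ _ => rfl
      map_smul' := fun _ _ => rfl } 1 (fun f => by
      rw [one_mul, BoundedContinuousFunction.norm_le (norm_nonneg _)]
      exact fun x => f.norm_coe_le_norm _)

theorem pull_apply (i : Bool) (f : BddFun) (x : Stream' Bool) :
    pull i f x = f (Stream'.cons i x) := rfl

theorem norm_pull_le (i : Bool) (f : BddFun) : ‖pull i f‖ ≤ ‖f‖ :=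
  (BoundedContinuousFunction.norm_le (norm_nonneg _)).2 fun _ => f.norm_coe_le_norm _

/-- The contraction `(a_i f)(j x) = f(x)` if `i = j`, and `0` otherwise. -/
def push (i : Bool) : BddFun →L[ℂ] BddFun :=
  LinearMap.mkContinuous
    { toFun := fun f => BoundedContinuousFunction.ofNormedAddCommGroupDiscrete
        (fun x => if x.head = i then f x.tail else 0) ‖f‖ (fun x => by
          split_ifs
          · exact f.norm_coe_le_norm _
          · simp)
      map_add' := fun f g => by
        ext x
        by_cases hx : x.head = i <;> simp [hx]
      map_smul' := fun c f => by
        ext x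
        by_cases hx : x.head = i <;> simp [hx] } 1 (fun f => by
      rw [one_mul, BoundedContinuousFunction.norm_le (norm_nonneg _)]
      intro x
      change ‖if x.head = i then f x.tail else 0‖ ≤ _
      split_ifs
      · exact f.norm_coe_le_norm _
      · simp)

theorem push_apply (i : Bool) (f : BddFun) (x : Stream' Bool) :
    push i f x = if x.head = i then f x.tail else 0 := rfl

theorem norm_push_le (i : Bool) (f : BddFun) : ‖push i f‖ ≤ ‖f‖ := by
  rw [BoundedContinuousFunction.norm_le (norm_nonneg _)]
  intro x
  rw [push_apply]
  split_ifs
  · exact f.norm_coe_le_norm _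
  · simp

theorem pull_mul_push (i j : Bool) : pull i * push j = if i = j then 1 else 0 := by
  ext f x
  change pull i (push j f) x = _
  rw [pull_apply, push_apply, Stream'.head_cons, Stream'.tail_cons]
  split_ifs <;> rfl

theorem sum_push_mul_pull : push true * pull true + push false * pull false = 1 := by
  ext f x
  change push true (pull true f) x + push false (pull false f) x = f x
  simp only [push_apply, pull_apply]
  rcases h : x.head
  · simp [← h, Stream'.eta]
  · simp [← h, Stream'.eta]

theorem bddFun_one_ne_zero : (1 : BddFun) ≠ 0 := fun h =>
  one_ne_zero (congrArg (fun f : BddFun => f (Stream'.const true)) h)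

/-- A presentation may collapse; a concrete representation on a nonzero space excludes this. -/
theorem cu₂_one_ne_zero : (1 : Cu₂) ≠ 0 := by
  intro h
  have := congrArg (cuLift push pull pull_mul_push) h
  rw [map_one, map_zero] at this
  exact bddFun_one_ne_zero (congrArg (fun T : BddFun →L[ℂ] BddFun => T 1) this)

instance : Nontrivial Cu₂ := ⟨1, 0, cu₂_one_ne_zero⟩

/-- The witness is the constant function `1`, which both operators `pull i` fix. -/
theorem norm_π𝒥_hElt_pow (N : ℕ) : ‖π𝒥 (hElt ^ N)‖ = 1 := by
  refine le_antisymm (norm_π𝒥_hElt_pow_le N) ?_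
  refine one_le_norm_π𝒥_hElt_pow (v := (1 : BddFun)) pull_mul_push (fun i f => norm_push_le i f)
    (fun i f => norm_pull_le i f) sum_push_mul_pull bddFun_one_ne_zero (fun i => rfl) N

/-! ### Cancellation and uniqueness for words -/

theorem word_ne_zero (α : List Bool) : word α ≠ 0 := by
  intro h
  have := coword_mul_word α
  rw [h, mul_zero] at this
  exact zero_ne_one this

theorem coword_cons_ne_one (i : Bool) (β : List Bool) : coword (i :: β) ≠ 1 := by
  intro h
  have h1 : coword (i :: β) * isom (!i) = 0 := by
    rw [coword, mul_assoc, coisom_mul_isom]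
    simp
  rw [h, one_mul] at h1
  have h2 := coisom_mul_isom (!i) (!i)
  rw [h1, mul_zero, if_pos rfl] at h2
  exact zero_ne_one h2

theorem word_cons_ne_one (i : Bool) (β : List Bool) : word (i :: β) ≠ 1 := by
  intro h
  have h1 : coisom (!i) * word (i :: β) = 0 := by
    rw [word, ← mul_assoc, coisom_mul_isom]
    simp
  rw [h, mul_one] at h1
  have h2 := coisom_mul_isom (!i) (!i)
  rw [h1, zero_mul, if_pos rfl] at h2
  exact zero_ne_one h2

theorem coisom_mul_word_cons (i j : Bool) (α : List Bool) :
    coisom i * word (j :: α) = if i = j then word α else 0 := by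
  rw [word, ← mul_assoc, coisom_mul_isom]
  split_ifs <;> simp

theorem coword_cons_mul_isom (i j : Bool) (α : List Bool) :
    coword (j :: α) * isom i = if j = i then coword α else 0 := by
  rw [coword, mul_assoc, coisom_mul_isom]
  split_ifs <;> simp

theorem word_injective : Function.Injective word := by
  intro α
  induction α with
  | nil =>
    intro β h
    cases β with
    | nil => rfl
    | cons j β => exact absurd h.symm (word_cons_ne_one j β)
  | cons i α ih =>
    intro β h
    cases β with
    | nil => exact absurd h (word_cons_ne_one i α)
    | cons j β =>
      have h1 := congrArg (coisom i * ·) h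
      simp only [coisom_mul_word_cons, if_true] at h1
      split_ifs at h1 with hij
      · rw [hij, ih h1]
      · exact absurd h1 (word_ne_zero α)

/-- The letters of `γ` are peeled off the left of the normal form of `x`; a mismatched letter would
make the product `0`. -/
theorem eq_word_of_coword_mul_eq_one (γ : List Bool) (x : Cu₂) (h : coword γ * x = 1) :
    x = word γ := by
  induction γ generalizing x with
  | nil => simpa [coword, word] using h
  | cons i γ ih =>
    rw [coword, mul_assoc] at h
    have h1 := ih _ h
    rcases eq_zero_or_eq_word_mul_coword x with rfl | ⟨α, β, rfl⟩
    · rw [mul_zero, mul_zero] at h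
      exact absurd h zero_ne_one
    · cases α with
      | nil =>
        rw [word, one_mul, ← coword_concat, ← coword_append] at h
        -- Here `x` is a pure coword, so the product is the coword of a nonempty word.
        cases β <;> exact absurd h (coword_cons_ne_one _ _)
      | cons j α =>
        rw [← mul_assoc, coisom_mul_word_cons] at h1
        split_ifs at h1 with hij
        · rw [word, mul_assoc, h1, hij, word]
        · rw [zero_mul] at h1
          exact absurd h1.symm (word_ne_zero γ)

/-! ### The limit state -/

/-- The word `1 ⋯ 1 2` with `k` letters `1`. -/
def spike (k : ℕ) : List Bool := List.replicate k true ++ [false]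

theorem spike_succ (k : ℕ) : spike (k + 1) = true :: spike k := rfl

/-- If `α` consists of `i` letters `1`, it cancels against the start of the spike. If it contains a
letter `2`, every long enough spike has a `1` in that position and the product vanishes. -/
theorem coword_spike_mul_word (α : List Bool) :
    (∃ i, ∀ k, coword (spike (k + i)) * word α = coword (spike k)) ∨
      ∃ K, ∀ k, coword (spike (k + K)) * word α = 0 := by
  induction α with
  | nil => exact Or.inl ⟨0, fun k => by simp [word]⟩
  | cons a α ih =>
    have e : ∀ k, coword (spike (k + 1)) * word (a :: α) =
        if true = a then coword (spike k) * word α else 0 := fun k => by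
      rw [spike_succ, coword, mul_assoc, coisom_mul_word_cons]
      split_ifs <;> simp
    cases a with
    | false => exact Or.inr ⟨1, fun k => by simp [e]⟩
    | true =>
      rcases ih with ⟨i, hi⟩ | ⟨i, hi⟩
      · exact Or.inl ⟨i + 1, fun k => by rw [← add_assoc, e, if_pos rfl, hi]⟩
      · exact Or.inr ⟨i + 1, fun k => by rw [← add_assoc, e, if_pos rfl, hi]⟩

theorem coword_mul_word_spike (α : List Bool) :
    (∃ i, ∀ k, coword α * word (spike (k + i)) = word (spike k)) ∨
      ∃ K, ∀ k, coword α * word (spike (k + K)) = 0 := by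
  induction α with
  | nil => exact Or.inl ⟨0, fun k => by simp [coword]⟩
  | cons a α ih =>
    have e : ∀ k, coword (a :: α) * word (spike (k + 1)) =
        if a = true then coword α * word (spike k) else 0 := fun k => by
      rw [spike_succ, coword, mul_assoc, coisom_mul_word_cons]
      split_ifs <;> simp
    cases a with
    | false => exact Or.inr ⟨1, fun k => by simp [e]⟩
    | true =>
      rcases ih with ⟨i, hi⟩ | ⟨i, hi⟩
      · exact Or.inl ⟨i + 1, fun k => by rw [← add_assoc, e, if_pos rfl, hi]⟩
      · exact Or.inr ⟨i + 1, fun k => by rw [← add_assoc, e, if_pos rfl, hi]⟩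

/-- Neither of two distinct spikes is a prefix of the other, so their isometries have orthogonal
ranges. This is the purpose of the final letter `2`. -/
theorem coword_spike_mul_word_spike (k l : ℕ) :
    coword (spike k) * word (spike l) = if k = l then 1 else 0 := by
  induction k generalizing l with
  | zero =>
    cases l with
    | zero => rw [coword_mul_word, if_pos rfl]
    | succ l =>
      change coword [false] * word (true :: spike l) = _
      rw [coword, mul_assoc, coisom_mul_word_cons]
      simp
  | succ k ih =>
    cases l with
    | zero =>
      change coword (true :: spike k) * word [false] = _
      rw [coword, mul_assoc, coisom_mul_word_cons]
      simp
    | succ l =>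
      rw [spike_succ, spike_succ, coword, mul_assoc, coisom_mul_word_cons, if_pos rfl, ih]
      simp

/-- Compressing an element of `Cu₂` along the words `1 ⋯ 1 2` gives eventually `1` or
eventually `0`. -/
theorem eventually_compression (t : Cu₂) :
    (∀ᶠ k in atTop, coword (spike k) * t * word (spike k) = 1) ∨
      ∀ᶠ k in atTop, coword (spike k) * t * word (spike k) = 0 := by
  rcases eq_zero_or_eq_word_mul_coword t with rfl | ⟨α, β, rfl⟩
  · exact Or.inr (by simp)
  have e : ∀ k, coword (spike k) * (word α * coword β) * word (spike k) =
      (coword (spike k) * word α) * (coword β * word (spike k)) := fun k => by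
    simp only [mul_assoc]
  simp only [e]
  rcases coword_spike_mul_word α with ⟨i, hi⟩ | ⟨i, hi⟩
  · rcases coword_mul_word_spike β with ⟨j, hj⟩ | ⟨j, hj⟩
    · have h : ∀ k, (coword (spike (k + i + j)) * word α) * (coword β * word (spike (k + i + j))) =
          if j = i then 1 else 0 := fun k => by
        -- The factors reduce to the spikes of lengths `k + j` and `k + i`, which pair to `1`
        -- exactly when `i = j`.
        rw [hj, show k + i + j = (k + j) + i by ring, hi, coword_spike_mul_word_spike]
        simp
      by_cases hij : j = i
      · refine Or.inl ((eventually_ge_atTop (i + j)).mono fun k hk => ?_)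
        obtain ⟨m, rfl⟩ := Nat.exists_eq_add_of_le' hk
        rw [← add_assoc, h, if_pos hij]
      · refine Or.inr ((eventually_ge_atTop (i + j)).mono fun k hk => ?_)
        obtain ⟨m, rfl⟩ := Nat.exists_eq_add_of_le' hk
        rw [← add_assoc, h, if_neg hij]
    · refine Or.inr ((eventually_ge_atTop j).mono fun k hk => ?_)
      obtain ⟨m, rfl⟩ := Nat.exists_eq_add_of_le' hk
      rw [hj, mul_zero]
  · refine Or.inr ((eventually_ge_atTop i).mono fun k hk => ?_)
    obtain ⟨m, rfl⟩ := Nat.exists_eq_add_of_le' hk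
    rw [hi, zero_mul]

/-- The elements of `Cu₂` on which the limit state is `1`. -/
def IsUnitLimit (t : Cu₂) : Prop := ∀ᶠ k in atTop, coword (spike k) * t * word (spike k) = 1

theorem not_isUnitLimit_zero : ¬ IsUnitLimit 0 := by
  intro h
  obtain ⟨k, hk⟩ := Eventually.exists h
  simp at hk

theorem isUnitLimit_one : IsUnitLimit 1 := by
  refine Eventually.of_forall fun k => ?_
  rw [mul_one, coword_mul_word]

/-- For one large `k`, both hypotheses determine `s s_{w_k}`: it equals `s_{α w_k}` and `s_{β w_k}`,
and the common suffix cancels. -/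
theorem isUnitLimit_coword_mul_unique {α β : List Bool} {s : Cu₂}
    (hα : IsUnitLimit (coword α * s)) (hβ : IsUnitLimit (coword β * s)) : α = β := by
  obtain ⟨k, h1, h2⟩ := (hα.and hβ).exists
  have e : ∀ γ, coword (spike k) * (coword γ * s) * word (spike k) = 1 →
      s * word (spike k) = word (γ ++ spike k) := fun γ h =>
    eq_word_of_coword_mul_eq_one _ _ (by rw [coword_append, ← h]; simp only [mul_assoc])
  have h3 := word_injective ((e α h1).symm.trans (e β h2))
  exact List.append_cancel_right h3

open Classical in
/-- The limit state on `Cu₂`. -/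
def limState (t : Cu₂) : ℂ := if IsUnitLimit t then 1 else 0

theorem norm_limState_le (t : Cu₂) : ‖limState t‖ ≤ 1 := by
  unfold limState
  split_ifs <;> simp

/-- The limit state on `𝒜`. -/
def limStateL : 𝒜 →L[ℂ] ℂ := extend limState norm_limState_le

theorem limStateL_delta (t : Cu₂) : limStateL (delta t) = limState t :=
  extend_delta _ _ (if_neg not_isUnitLimit_zero) t

/-- The two-sided multiplication `f ↦ δ_s # f # δ_t`. -/
def compress (s t : Cu₂) : 𝒜 →L[ℂ] 𝒜 := (mulL.flip (delta t)).comp (mulL (delta s))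

theorem compress_apply (s t : Cu₂) (f : 𝒜) : compress s t f = delta s * f * delta t := rfl

theorem compress_delta (s t x : Cu₂) : compress s t (delta x) = delta (s * x * t) := by
  rw [compress_apply, delta_mul_delta, delta_mul_delta]

theorem tendsto_compress (f : 𝒜) :
    Tendsto (fun k => delta (coword (spike k)) * f * delta (word (spike k))) atTop
      (𝓝 (limStateL f • (1 : 𝒜))) := by
  refine tendsto_apply_of_delta (fun k => compress (coword (spike k)) (word (spike k)))
    (limStateL.smulRight (1 : 𝒜)) (fun k s => ?_) (fun s => ?_) f
  · rw [compress_delta]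
    exact norm_delta_le _
  · simp only [compress_delta]
    refine tendsto_const_nhds.congr' ?_
    rw [ContinuousLinearMap.smulRight_apply, limStateL_delta]
    rcases eventually_compression s with h | h
    · rw [limState, if_pos (show IsUnitLimit s from h)]
      filter_upwards [h] with k hk
      rw [hk, one_smul, one_def]
    · have h' : ¬ IsUnitLimit s := fun h1 => by
        obtain ⟨k, h2, h3⟩ := (h1.and h).exists
        exact zero_ne_one (h3.symm.trans h2)
      rw [limState, if_neg h']
      filter_upwards [h] with k hk
      rw [hk, zero_smul, delta_zero]

/-! ### Reconstruction of an element modulo `𝒥` from its matrix coefficients -/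

open Classical in
/-- The point mass at `s_μ` if the limit state of `s_μ* s` is `1`, and `0` if there is no
such `μ`. -/
def creation (s : Cu₂) : 𝒜 :=
  if h : ∃ α, IsUnitLimit (coword α * s) then delta (word h.choose) else 0

theorem creation_of_isUnitLimit {α : List Bool} {s : Cu₂} (h : IsUnitLimit (coword α * s)) :
    creation s = delta (word α) := by
  have h' : ∃ α, IsUnitLimit (coword α * s) := ⟨α, h⟩
  rw [creation, dif_pos h', isUnitLimit_coword_mul_unique h'.choose_spec h]

theorem norm_creation_le (s : Cu₂) : ‖creation s‖ ≤ 1 := by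
  unfold creation
  split_ifs
  · exact norm_delta_le _
  · simp

theorem creation_zero : creation 0 = 0 := by
  rw [creation, dif_neg]
  rintro ⟨α, h⟩
  rw [mul_zero] at h
  exact not_isUnitLimit_zero h

/-- The linear extension of `creation`. -/
def creationL : 𝒜 →L[ℂ] 𝒜 := extend creation norm_creation_le

theorem creationL_delta (s : Cu₂) : creationL (delta s) = creation s :=
  extend_delta _ _ creation_zero s

theorem creationL_delta_word (α : List Bool) : creationL (delta (word α)) = delta (word α) := by
  rw [creationL_delta, creation_of_isUnitLimit]
  rw [coword_mul_word]
  exact isUnitLimit_one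

/-- The coordinate functionals of `𝒜`. -/
def coord (t : {s : Cu₂ // s ≠ 0}) : 𝒜 →L[ℂ] ℂ := lp.evalCLM ℂ (fun _ => ℂ) 1 t

theorem coord_delta_self (t : {s : Cu₂ // s ≠ 0}) : coord t (delta t) = 1 := by
  classical
  rw [delta_eq_single]
  change (lp.single 1 t (1 : ℂ) : 𝒜) t = 1
  simp

theorem coord_delta_of_ne {t : {s : Cu₂ // s ≠ 0}} {s : Cu₂} (h : s ≠ t) :
    coord t (delta s) = 0 := by
  classical
  by_cases hs : s = 0
  · rw [hs, delta_zero, map_zero]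
  · have := delta_eq_single (⟨s, hs⟩ : {s : Cu₂ // s ≠ 0})
    rw [show delta s = _ from this]
    change (lp.single 1 _ (1 : ℂ) : 𝒜) t = 0
    rw [lp.single_apply_ne]
    exact fun h' => h (congrArg Subtype.val h').symm

/-- Uniqueness of `α` makes at most one coefficient nonzero on each point mass. This is why `∑_α
χ(s_α* f) s_α` is absolutely summable and is given by `creationL`. -/
theorem coord_creationL_word (α : List Bool) (f : 𝒜) :
    coord ⟨word α, word_ne_zero α⟩ (creationL f) = limStateL (delta (coword α) * f) := by
  have : (coord ⟨word α, word_ne_zero α⟩).comp creationL =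
      limStateL.comp (mulL (delta (coword α))) := ext_delta fun s => by
    change coord _ (creationL (delta s)) = limStateL (delta (coword α) * delta s)
    rw [delta_mul_delta, limStateL_delta, creationL_delta, limState]
    split_ifs with h
    · rw [creation_of_isUnitLimit h]
      exact coord_delta_self ⟨word α, word_ne_zero α⟩
    · by_cases h' : ∃ β, IsUnitLimit (coword β * s)
      · obtain ⟨β, hβ⟩ := h'
        rw [creation_of_isUnitLimit hβ]
        refine coord_delta_of_ne fun e => h ?_
        rwa [← word_injective e]
      · rw [creation, dif_neg h', map_zero]
  exact congrArg (fun T : 𝒜 →L[ℂ] ℂ => T f) this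

theorem coord_creationL_of_forall_ne {t : {s : Cu₂ // s ≠ 0}} (ht : ∀ α, word α ≠ t) (f : 𝒜) :
    coord t (creationL f) = 0 := by
  have : (coord t).comp creationL = 0 := ext_delta fun s => by
    change coord t (creationL (delta s)) = 0
    rw [creationL_delta, creation]
    split_ifs with h
    · exact coord_delta_of_ne (ht _)
    · exact map_zero _
  exact congrArg (fun T : 𝒜 →L[ℂ] ℂ => T f) this

theorem creationL_eq_zero {f : 𝒜} (h : ∀ α, limStateL (delta (coword α) * f) = 0) :
    creationL f = 0 := by
  ext t
  change coord t (creationL f) = 0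
  by_cases ht : ∃ α, word α = t
  · obtain ⟨α, hα⟩ := ht
    obtain rfl : t = ⟨word α, word_ne_zero α⟩ := Subtype.ext hα.symm
    rw [coord_creationL_word, h]
  · exact coord_creationL_of_forall_ne (not_exists.1 ht) f

/-- The quotient map as a continuous linear map. -/
def π𝒥L : 𝒜 →L[ℂ] 𝒜 ⧸ 𝒥 :=
  LinearMap.mkContinuous
    { toFun := π𝒥
      map_add' := fun _ _ => rfl
      map_smul' := fun _ _ => rfl } 1 (fun f => by
      rw [one_mul]
      exact norm_π𝒥_le f)

theorem π𝒥L_apply (f : 𝒜) : π𝒥L f = π𝒥 f := rfl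

/-- The operators with `R₀(f) = π(∑_μ χ(s_μ* f) s_μ)` and `R_{n+1}(f) = ∑_i R_n(f s_i) s_i*`. -/
def recon : ℕ → 𝒜 →L[ℂ] 𝒜 ⧸ 𝒥
  | 0 => π𝒥L.comp creationL
  | n + 1 => ∑ i : Bool, ((ContinuousLinearMap.mul ℂ (𝒜 ⧸ 𝒥)).flip (π𝒥 (delta (coisom i)))).comp
      ((recon n).comp (mulL.flip (delta (isom i))))

theorem recon_succ_apply (n : ℕ) (f : 𝒜) :
    recon (n + 1) f = ∑ i : Bool, recon n (f * delta (isom i)) * π𝒥 (delta (coisom i)) := by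
  rw [recon, _root_.sum_apply]
  rfl

theorem sum_π𝒥_delta_isom_coisom : ∑ i : Bool, π𝒥 (delta (isom i * coisom i)) = 1 := by
  have h : π𝒥 f₀ = 0 :=
    Ideal.Quotient.eq_zero_iff_mem.2 (Submodule.mem_sInf.2 fun I hI => hI.2.2)
  have h' : π𝒥 (delta 1 - delta (isom true * coisom true) - delta (isom false * coisom false)) = 0 :=
    h
  rw [map_sub, map_sub, sub_sub, sub_eq_zero] at h'
  rw [Fintype.sum_bool, ← h']
  exact map_one π𝒥

/-- `creationL` fixes words, and each recursion step only inserts `∑ s_i s_i* = 1`, valid in the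
quotient. -/
theorem recon_delta_word (n : ℕ) (α : List Bool) :
    recon n (delta (word α)) = π𝒥 (delta (word α)) := by
  induction n generalizing α with
  | zero =>
    change π𝒥 (creationL (delta (word α))) = _
    rw [creationL_delta_word]
  | succ n ih =>
    have e : ∀ i, isom i = word [i] := fun i => by simp [word]
    rw [recon_succ_apply]
    calc _ = ∑ i : Bool, π𝒥 (delta (word α)) * π𝒥 (delta (isom i * coisom i)) := by
          refine Finset.sum_congr rfl fun i _ => ?_
          rw [delta_mul_delta, e, ← word_append, ih, ← map_mul, ← map_mul, delta_mul_delta,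
            delta_mul_delta, word_append, mul_assoc]
      _ = _ := by rw [← Finset.mul_sum, sum_π𝒥_delta_isom_coisom, mul_one]

theorem recon_succ_delta (n : ℕ) (α : List Bool) (j : Bool) (β : List Bool) :
    recon (n + 1) (delta (word α * coword (j :: β))) =
      recon n (delta (word α * coword β)) * π𝒥 (delta (coisom j)) := by
  rw [recon_succ_apply, Finset.sum_eq_single j]
  · rw [delta_mul_delta, mul_assoc, coword_cons_mul_isom, if_pos rfl]
  · intro i _ hi
    rw [delta_mul_delta, mul_assoc, coword_cons_mul_isom, if_neg hi.symm, mul_zero, delta_zero,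
      map_zero, zero_mul]
  · simp

theorem norm_π𝒥_delta_le (s : Cu₂) : ‖π𝒥 (delta s)‖ ≤ 1 := (norm_π𝒥_le _).trans (norm_delta_le s)

/-- This is the domination needed for convergence. The number of summands does not matter: `s_{jβ}*
s_i = 0` unless `i = j`, so a single term survives, while pure words are reproduced exactly. -/
theorem norm_recon_delta_le (n : ℕ) (s : Cu₂) : ‖recon n (delta s)‖ ≤ 1 := by
  rcases eq_zero_or_eq_word_mul_coword s with rfl | ⟨α, β, rfl⟩
  · rw [delta_zero, map_zero, norm_zero]
    exact zero_le_one
  induction n generalizing β with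
  | zero =>
    change ‖π𝒥 (creationL (delta _))‖ ≤ 1
    rw [creationL_delta]
    exact (norm_π𝒥_le _).trans (norm_creation_le _)
  | succ n ih =>
    cases β with
    | nil =>
      rw [coword, mul_one, recon_delta_word]
      exact norm_π𝒥_delta_le _
    | cons j β =>
      rw [recon_succ_delta]
      exact (norm_mul_le _ _).trans (mul_le_one₀ (ih β) (norm_nonneg _) (norm_π𝒥_delta_le _))

theorem recon_delta_of_length_le {n : ℕ} (α : List Bool) {β : List Bool} (h : β.length ≤ n) :
    recon n (delta (word α * coword β)) = π𝒥 (delta (word α * coword β)) := by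
  induction n generalizing β with
  | zero =>
    obtain rfl := List.length_eq_zero_iff.1 (Nat.le_zero.1 h)
    rw [coword, mul_one, recon_delta_word]
  | succ n ih =>
    cases β with
    | nil => rw [coword, mul_one, recon_delta_word]
    | cons j β =>
      rw [recon_succ_delta, ih (by simpa using h), ← map_mul, delta_mul_delta, coword, mul_assoc]

/-- On a point mass `s_α s_β*` the sequence is constant once `n ≥ |β|`; the uniform bound passes
this to all of `ℓ¹`. -/
theorem tendsto_recon (f : 𝒜) : Tendsto (fun n => recon n f) atTop (𝓝 (π𝒥 f)) := by
  refine tendsto_apply_of_delta recon π𝒥L norm_recon_delta_le (fun s => ?_) f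
  refine tendsto_const_nhds.congr' ?_
  rcases eq_zero_or_eq_word_mul_coword s with rfl | ⟨α, β, rfl⟩
  · simp [delta_zero]
  · filter_upwards [eventually_ge_atTop β.length] with n hn
    rw [recon_delta_of_length_le α hn, π𝒥L_apply]

theorem recon_eq_zero (n : ℕ) {f : 𝒜}
    (h : ∀ α β, limStateL (delta (coword α) * (f * delta (word β))) = 0) : recon n f = 0 := by
  induction n generalizing f with
  | zero =>
    change π𝒥 (creationL f) = 0
    rw [creationL_eq_zero, map_zero]
    intro α
    have := h α []
    rwa [word, ← one_def, mul_one] at this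
  | succ n ih =>
    rw [recon_succ_apply]
    refine Finset.sum_eq_zero fun i _ => ?_
    rw [ih, zero_mul]
    intro α β
    -- The hypothesis is stable under `f ↦ f s_i`, since `s_i s_β = s_{iβ}`.
    have := h α (i :: β)
    rwa [word, ← delta_mul_delta, ← mul_assoc f] at this

/-- An element all of whose matrix coefficients vanish lies in `𝒥`. -/
theorem π𝒥_eq_zero_of_limStateL {f : 𝒜}
    (h : ∀ α β, limStateL (delta (coword α) * (f * delta (word β))) = 0) : π𝒥 f = 0 := by
  refine tendsto_nhds_unique (tendsto_recon f) ?_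
  simp only [recon_eq_zero _ h]
  exact tendsto_const_nhds

/-! ### Injectivity of continuous homomorphisms -/

/-- A continuous homomorphism from `𝒜/𝒥` to a normed algebra with `Θ 1 ≠ 0` is injective. -/
theorem injective_of_map_one_ne_zero {B : Type} [NormedRing B] [NormedAlgebra ℂ B]
    (Θ : (𝒜 ⧸ 𝒥) →ₙₐ[ℂ] B) (hΘ : Continuous Θ) (h1 : Θ 1 ≠ 0) : Function.Injective Θ := by
  rw [injective_iff_map_eq_zero]
  intro a ha
  obtain ⟨f, rfl⟩ := Ideal.Quotient.mk_surjective a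
  -- All compressions of `g` are killed by `Θ`, hence so is their limit `χ(g) 1`; this uses `Θ 1 ≠
  -- 0`.
  have key : ∀ g : 𝒜, Θ (π𝒥 g) = 0 → limStateL g = 0 := by
    intro g hg
    have h2 := ((hΘ.comp π𝒥L.continuous).tendsto _).comp (tendsto_compress g)
    have h3 : Tendsto (fun _ : ℕ => (0 : B)) atTop (𝓝 (Θ (π𝒥L (limStateL g • (1 : 𝒜))))) := by
      refine h2.congr fun k => ?_
      change Θ (π𝒥 (_ * g * _)) = 0
      rw [map_mul, map_mul, map_mul, map_mul, hg, mul_zero, zero_mul]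
    have h4 := tendsto_nhds_unique h3 tendsto_const_nhds
    rw [map_smul, map_smul, π𝒥L_apply, map_one] at h4
    exact (smul_eq_zero.1 h4).resolve_right h1
  refine π𝒥_eq_zero_of_limStateL fun α β => key _ ?_
  rw [map_mul, map_mul, map_mul, map_mul, ha, zero_mul, mul_zero]

/-! ### Averages of coordinates on `ℓᵖ` -/

section Average

variable (p : ℝ≥0∞) [Fact (1 ≤ p)]

theorem coe_two_mul_sub_one (n : ℕ+) : ((2 * n - 1 : ℕ+) : ℕ) = 2 * n - 1 := by
  have h : (1 : ℕ+) < 2 * n := by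
    rw [← PNat.coe_lt_coe, PNat.mul_coe]
    have := n.pos
    simp
    lia
  simp [PNat.sub_coe, h]

theorem eq_two_mul_or (n : ℕ+) : ∃ m : ℕ+, n = 2 * m ∨ n = 2 * m - 1 := by
  have hn := n.pos
  obtain ⟨m, hm⟩ : ∃ m : ℕ+, (m : ℕ) = (n + 1) / 2 :=
    ⟨Nat.toPNat ((n + 1) / 2) (by lia), rfl⟩
  refine ⟨m, ?_⟩
  rcases Nat.even_or_odd' (n : ℕ) with ⟨k, h | h⟩
  · refine Or.inl (PNat.eq ?_)
    rw [PNat.mul_coe, PNat.val_ofNat]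
    lia
  · refine Or.inr (PNat.eq ?_)
    rw [coe_two_mul_sub_one]
    lia

theorem ext_of_A (hp : p ≠ ∞) {x y : ellp p} (h1 : A₁ p hp x = A₁ p hp y)
    (h2 : A₂ p hp x = A₂ p hp y) : x = y := by
  ext n
  obtain ⟨m, rfl | rfl⟩ := eq_two_mul_or n
  · exact congrArg (fun z : ellp p => z m) h1
  · exact congrArg (fun z : ellp p => z m) h2

/-- The averaging operator `(A₁ + A₂) / 2`. -/
def avg (hp : p ≠ ∞) : ellp p →L[ℂ] ellp p := (1 / 2 : ℂ) • (A₁ p hp + A₂ p hp)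

theorem avg_apply (hp : p ≠ ∞) (x : ellp p) (n : ℕ+) :
    avg p hp x n = (x (2 * n) + x (2 * n - 1)) / 2 := by
  change (1 / 2 : ℂ) * (x (2 * n) + x (2 * n - 1)) = _
  ring

theorem norm_add_div_two_rpow_le {r : ℝ} (hr : 1 ≤ r) (a b : ℂ) :
    ‖(a + b) / 2‖ ^ r ≤ (‖a‖ ^ r + ‖b‖ ^ r) / 2 := by
  have h := (convexOn_rpow hr).2 (Set.mem_Ici.2 (norm_nonneg a)) (Set.mem_Ici.2 (norm_nonneg b))
    (show (0 : ℝ) ≤ 1 / 2 by norm_num) (show (0 : ℝ) ≤ 1 / 2 by norm_num) (by norm_num)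
  simp only [smul_eq_mul] at h
  have h1 : ‖(a + b) / 2‖ ≤ 1 / 2 * ‖a‖ + 1 / 2 * ‖b‖ := by
    rw [norm_div]
    have := norm_add_le a b
    norm_num
    linarith
  refine (Real.rpow_le_rpow (norm_nonneg _) h1 (by linarith)).trans (h.trans (le_of_eq ?_))
  ring

theorem one_le_toReal (hp : p ≠ ∞) : 1 ≤ p.toReal := by
  rw [← ENNReal.toReal_one]
  exact ENNReal.toReal_mono hp Fact.out

theorem tsum_even_add_tsum_odd {f : ℕ+ → ℝ} (hf : Summable f) :
    ∑' n, f (2 * n) + ∑' n, f (2 * n - 1) = ∑' n, f n := by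
  have h1 : HasSum (fun n : Set.range (fun n : ℕ+ => 2 * n) => f n) (∑' n, f (2 * n)) :=
    (two_mul_injective.hasSum_range_iff (f := f)).2
      (hf.comp_injective two_mul_injective).hasSum
  have h2 : HasSum (fun n : Set.range (fun n : ℕ+ => 2 * n - 1) => f n) (∑' n, f (2 * n - 1)) :=
    (two_mul_sub_one_injective.hasSum_range_iff (f := f)).2
      (hf.comp_injective two_mul_sub_one_injective).hasSum
  have hc : IsCompl (Set.range (fun n : ℕ+ => 2 * n)) (Set.range (fun n : ℕ+ => 2 * n - 1)) := by
    refine IsCompl.of_eq ?_ ?_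
    · ext n
      simp only [Set.inf_eq_inter, Set.bot_eq_empty, Set.mem_inter_iff, Set.mem_range,
        Set.mem_empty_iff_false, iff_false, not_and, not_exists]
      rintro ⟨a, rfl⟩ b h
      have h' := congrArg PNat.val h
      rw [coe_two_mul_sub_one, PNat.mul_coe] at h'
      have := b.pos
      simp at h'
      lia
    · ext n
      obtain ⟨m, rfl | rfl⟩ := eq_two_mul_or n
      · simp
      · simp
  exact ((h1.add_isCompl hc h2).tsum_eq).symm

/-- Convexity gives a factor `1/2` on `p`-th powers, and the even and odd indices together exhaust
the sum for `x`. -/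
theorem norm_avg_apply_le (hp : p ≠ ∞) (x : ellp p) :
    ‖avg p hp x‖ ≤ (2 : ℝ) ^ (-(1 : ℝ) / p.toReal) * ‖x‖ := by
  have hr := one_le_toReal p hp
  have hp0 : 0 < p.toReal := by linarith
  have hs := (lp.memℓp x).summable hp0
  refine lp.norm_le_of_tsum_le hp0 (by positivity) ?_
  rw [Real.mul_rpow (by positivity) (norm_nonneg _), ← Real.rpow_mul (by norm_num),
    div_mul_cancel₀ _ hp0.ne', Real.rpow_neg_one, lp.norm_rpow_eq_tsum hp0 x,
    ← tsum_even_add_tsum_odd hs]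
  have s1 := hs.comp_injective two_mul_injective
  have s2 := hs.comp_injective two_mul_sub_one_injective
  refine le_trans ?_ (congrArg (2⁻¹ * ·) (s1.tsum_add s2)).le
  simp only [← tsum_mul_left]
  refine ((lp.memℓp (avg p hp x)).summable hp0).tsum_le_tsum (fun n => ?_)
    ((s1.add s2).mul_left _)
  rw [avg_apply]
  refine (norm_add_div_two_rpow_le hr _ _).trans (le_of_eq ?_)
  simp only [Function.comp_apply]
  ring

/-- The indicator function of `{1, …, m}`. -/
def initialIndicator (m : ℕ+) : ellp p := ∑ i ∈ Finset.Icc 1 m, lp.single p i (1 : ℂ)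

omit [Fact (1 ≤ p)] in
theorem initialIndicator_apply (m n : ℕ+) :
    initialIndicator p m n = if n ≤ m then 1 else 0 := by
  rw [initialIndicator, lp.coeFn_sum, Finset.sum_apply]
  simp [lp.single_apply, Pi.single_apply]

theorem norm_initialIndicator (hp : p ≠ ∞) (m : ℕ+) :
    ‖initialIndicator p m‖ = (m : ℝ) ^ (1 / p.toReal) := by
  have hp0 : 0 < p.toReal := by linarith [one_le_toReal p hp]
  have h := lp.norm_sum_single hp0 (fun _ : ℕ+ => (1 : ℂ)) (Finset.Icc 1 m)
  rw [norm_one, Real.one_rpow, Finset.sum_const, PNat.card_Icc, nsmul_eq_mul, mul_one] at h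
  have h2 : ‖initialIndicator p m‖ ^ p.toReal = (m : ℝ) := by
    simpa [initialIndicator] using h
  rw [← h2, ← Real.rpow_mul (norm_nonneg _), mul_one_div_cancel hp0.ne', Real.rpow_one]

/-- These indicators are extremal: halving the support divides the norm by exactly `2 ^ (1/p)`. -/
theorem avg_initialIndicator (hp : p ≠ ∞) (m : ℕ+) :
    avg p hp (initialIndicator p (2 * m)) = initialIndicator p m := by
  ext n
  rw [avg_apply, initialIndicator_apply, initialIndicator_apply, initialIndicator_apply]
  have h1 : 2 * n ≤ 2 * m ↔ n ≤ m := by simp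
  have h2 : 2 * n - 1 ≤ 2 * m ↔ n ≤ m := by
    rw [← PNat.coe_le_coe, coe_two_mul_sub_one, PNat.mul_coe, ← PNat.coe_le_coe n, PNat.val_ofNat]
    have := n.pos
    lia
  simp only [h1, h2]
  split_ifs <;> norm_num

theorem two_rpow_neg_div (r : ℝ) (N : ℕ) :
    (2 : ℝ) ^ (-(N : ℝ) / r) = ((2 : ℝ) ^ (-(1 : ℝ) / r)) ^ N := by
  rw [← Real.rpow_mul_natCast (by norm_num)]
  congr 1
  ring

theorem norm_avg_pow (hp : p ≠ ∞) (N : ℕ) :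
    ‖avg p hp ^ N‖ = (2 : ℝ) ^ (-(N : ℝ) / p.toReal) := by
  have hp0 : 0 < p.toReal := by linarith [one_le_toReal p hp]
  refine le_antisymm ?_ ?_
  · rw [two_rpow_neg_div]
    refine ContinuousLinearMap.opNorm_le_bound _ (by positivity) fun x => ?_
    induction N generalizing x with
    | zero => simp
    | succ N ih =>
      rw [pow_succ, pow_succ]
      change ‖(avg p hp ^ N) (avg p hp x)‖ ≤ _
      refine (ih _).trans ?_
      rw [mul_assoc]
      exact mul_le_mul_of_nonneg_left (norm_avg_apply_le p hp x) (by positivity)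
  · have h : (avg p hp ^ N) (initialIndicator p (2 ^ N)) = initialIndicator p 1 := by
      induction N with
      | zero => simp
      | succ N ih =>
        rw [pow_succ, pow_succ']
        change (avg p hp ^ N) (avg p hp _) = _
        rw [avg_initialIndicator, ih]
    have h2 := (avg p hp ^ N).le_opNorm (initialIndicator p (2 ^ N))
    rw [h, norm_initialIndicator p hp, norm_initialIndicator p hp] at h2
    rw [neg_div, Real.rpow_neg (by norm_num), inv_eq_one_div, div_le_iff₀ (by positivity)]
    have e2 : ((2 ^ N : ℕ+) : ℝ) ^ (1 / p.toReal) = (2 : ℝ) ^ ((N : ℝ) / p.toReal) := by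
      rw [div_eq_mul_one_div (N : ℝ), Real.rpow_mul (by norm_num), Real.rpow_natCast]
      simp
    rw [e2] at h2
    simpa using h2

end Average

end CuntzAlg

end

open CuntzAlg in
theorem proposition3p18 (p : ℝ≥0∞) [Fact (1 ≤ p)] (hp : p ≠ ∞)
    (Θ : (𝒜 ⧸ 𝒥) →ₙₐ[ℂ] (ellp p →L[ℂ] ellp p)) (hΘ : Continuous Θ)
    (h₁ : Θ (π𝒥 (delta (gen .s₁star))) = A₁ p hp)
    (h₂ : Θ (π𝒥 (delta (gen .s₂star))) = A₂ p hp) :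
    Function.Injective Θ ∧ ¬ BoundedBelow Θ ∧
      ∀ N : ℕ, ‖π𝒥 (hElt ^ N)‖ = 1 ∧ ‖Θ (π𝒥 (hElt ^ N))‖ = (2 : ℝ) ^ (-(N : ℝ) / p.toReal) := by
  -- Unitality is automatic: `A_i Θ(1) = A_i` for both `i`, and `A₁`, `A₂` are jointly injective.
  have hone : Θ 1 = 1 := by
    ext1 x
    refine ext_of_A p hp ?_ ?_
    · change (A₁ p hp * Θ 1) x = _
      rw [← h₁, ← map_mul, mul_one]
      rfl
    · change (A₂ p hp * Θ 1) x = _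
      rw [← h₂, ← map_mul, mul_one]
      rfl
  have hindicator : initialIndicator p 1 ≠ 0 := fun h => by
    have := congrArg (fun x : ellp p => x 1) h
    simp [initialIndicator_apply] at this
  have hone_ne : Θ 1 ≠ 0 := fun h => hindicator <| by
    rw [hone] at h
    exact congrArg (fun T : ellp p →L[ℂ] ellp p => T (initialIndicator p 1)) h
  have havg : Θ (π𝒥 hElt) = avg p hp := by
    have e : π𝒥 hElt = (1 / 2 : ℂ) • (π𝒥 (delta (gen .s₁star)) + π𝒥 (delta (gen .s₂star))) := rfl
    rw [e, map_smul, map_add, h₁, h₂, avg]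
  have hpow : ∀ N : ℕ, Θ (π𝒥 (hElt ^ N)) = avg p hp ^ N := by
    intro N
    rw [map_pow]
    induction N with
    | zero => rw [pow_zero, pow_zero, hone]
    | succ N ih => rw [pow_succ, pow_succ, map_mul, ih, havg]
  have hnorm : ∀ N : ℕ, ‖π𝒥 (hElt ^ N)‖ = 1 ∧
      ‖Θ (π𝒥 (hElt ^ N))‖ = (2 : ℝ) ^ (-(N : ℝ) / p.toReal) := fun N =>
    ⟨norm_π𝒥_hElt_pow N, by rw [hpow, norm_avg_pow]⟩
  refine ⟨injective_of_map_one_ne_zero Θ hΘ hone_ne, ?_, hnorm⟩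
  rintro ⟨c, hc, h⟩
  have hp0 : 0 < p.toReal := by linarith [one_le_toReal p hp]
  have hlt : (2 : ℝ) ^ (-(1 : ℝ) / p.toReal) < 1 :=
    Real.rpow_lt_one_of_one_lt_of_neg (by norm_num) (div_neg_of_neg_of_pos (by norm_num) hp0)
  obtain ⟨N, hN⟩ := exists_pow_lt_of_lt_one hc hlt
  have h3 := h (π𝒥 (hElt ^ N))
  rw [(hnorm N).1, (hnorm N).2, mul_one] at h3
  rw [two_rpow_neg_div] at h3
  exact absurd h3 hN.not_ge
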